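/- Let $p$ be a prime, $k$ a perfect field of characteristic $p$, $W=W(k)$, $K_0=\mathrm{Frac}(W)$, and let $K/K_0$ be a finite totally ramified extension of degree $e$ with ring of integers $\mathcal{O}_K$ and uniformiser $\pi$. Let $E\in W[u]$ be the minimal polynomial of $\pi$ over $W$, and put $a=\lceil \log_p(\tfrac{e}{p-1})\rceil$. Let $\mathfrak{S}=W[[u]]$ with the Frobenius $\phi\colon \sum_j a_ju^j\mapsto\sum_j\phi_W(a_j)u^{pj}$, and identify $\mathfrak{S}/E$ with $\mathcal{O}_K$ via $u\mapsto\pi$. For an $\mathfrak{S}$-module $\mathfrak{M}$ and $n\ge 0$ write $\mathfrak{M}^{(n)}=\mathfrak{M}\otimes_{\mathfrak{S},\phi^n}\mathfrak{S}$, write $\mathfrak{M}[E]$ for the kernel of multiplication by $E$ on $\mathfrak{M}$, which is an $\mathcal{O}_K$-module, and let $\ell_{\mathcal{O}_K}$ denote length over $\mathcal{O}_K$. A quasi-filtered Breuil–Kisin module of height $i\ge 1$ consists of $\mathfrak{S}$-modules $\mathfrak{M}$ and $\mathfrak{N}$, with $\mathfrak{M}$ finitely generated, and $\mathfrak{S}$-linear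 maps $f\colon\mathfrak{M}^{(1)}\to\mathfrak{N}$, $g\colon\mathfrak{N}\to\mathfrak{M}^{(1)}$, $h\colon\mathfrak{N}\to\mathfrak{M}$ and $h'\colon\mathfrak{M}\to\mathfrak{N}$ such that $h$ is injective, $g\circ f=E^{i-1}\cdot\mathrm{id}$, $f\circ g=E^{i-1}\cdot\mathrm{id}$, $h'\circ h=E\cdot\mathrm{id}$ and $h\circ h'=E\cdot\mathrm{id}$. Let such a module of height $i\le 2$ be given, and suppose that $\mathfrak{M}$ is $u^\infty$-torsion (every element is killed by a power of $u$). Let $\alpha(\mathfrak{M})\ge 0$ be the integer with $\mathrm{Ann}(\mathfrak{M})+(p)=(p,u^{\alpha(\mathfrak{M})})$. Assume that $p\,\alpha(\mathfrak{M})\neq e$ and $e<p(p-1)$. Then $$\ell_{\mathcal{O}_K}\big(\mathfrak{M}^{(n+1)}[E]\big)\ \ge\ \ell_{\mathcal{O}_K}\big(\mathfrak{M}^{(n)}[E]\big)\quad\text{for all } n\ge 0,$$ and $$e\cdot\ell_{\mathcal{O}_K}\big(\mathfrak{M}^{(1)}[E]\big)\ \ge\ \ell_{\mathcal{O}_K}\big(\mathfrak{M}^{(a+1)}[E]\big).$$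 -/

import Mathlib

namespace BreuilKisin

open IsLocalRing Polynomial

section TotallyRamified

variable {R O : Type*} [CommRing R] [IsDomain R] [IsDiscreteValuationRing R]
  [CommRing O] [IsDedekindDomain O] [Algebra R O] [Module.Finite R O]
  [Module.IsTorsionFree R O]

theorem totRam_unique (P : Ideal O) [P.IsPrime] [P.LiesOver (maximalIdeal R)]
    (h : P.ramificationIdx R = Module.finrank R O) :
    P.inertiaDeg R = 1 ∧ ∀ Q : Ideal O, Q.IsPrime → Q.LiesOver (maximalIdeal R) → Q = P := by
  classical
  have : Module.Free R O := inferInstance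
  have hfin : Finite ((maximalIdeal R).primesOver O) := inferInstance
  let _ : Fintype ((maximalIdeal R).primesOver O) := Fintype.ofFinite _
  have hs := Ideal.sum_ramification_inertia_eq_finrank (maximalIdeal R) O
  let P' : (maximalIdeal R).primesOver O := ⟨P, ‹_›, ‹_›⟩
  have hePpos : 0 < P.ramificationIdx R := Ideal.ramificationIdx_pos P R
  have hfPpos : 0 < P.inertiaDeg R := Ideal.inertiaDeg_pos P R
  rw [← Finset.add_sum_erase _ _ (Finset.mem_univ P'), ← h] at hs
  have h1 : P.ramificationIdx R ≤ P.ramificationIdx R * P.inertiaDeg R :=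
    Nat.le_mul_of_pos_right _ hfPpos
  change P.ramificationIdx R * P.inertiaDeg R + _ = _ at hs
  constructor
  · have : P.ramificationIdx R * P.inertiaDeg R = P.ramificationIdx R * 1 := by omega
    exact Nat.eq_of_mul_eq_mul_left hePpos this
  · intro Q hQ hQ'
    by_contra hne
    let Q' : (maximalIdeal R).primesOver O := ⟨Q, hQ, hQ'⟩
    have hmem : Q' ∈ Finset.univ.erase P' := by
      simp only [Finset.mem_erase, Finset.mem_univ, and_true]
      intro hc; exact hne (congrArg Subtype.val hc)
    have h2 := Finset.single_le_sum (f := fun q : (maximalIdeal R).primesOver O =>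
      q.1.ramificationIdx R * q.1.inertiaDeg R) (fun _ _ => Nat.zero_le _) hmem
    have h3 : 0 < Q.ramificationIdx R * Q.inertiaDeg R :=
      Nat.mul_pos (Ideal.ramificationIdx_pos Q R) (Ideal.inertiaDeg_pos Q R)
    change Q.ramificationIdx R * Q.inertiaDeg R ≤ _ at h2
    omega

theorem totRam_span (P : Ideal O) [P.IsPrime] [P.LiesOver (maximalIdeal R)]
    (h : P.ramificationIdx R = Module.finrank R O) {ϖ : O} (hϖ : Irreducible ϖ) :
    P = Ideal.span {ϖ} ∧ ∃ j, ϖ ^ j ∈ (maximalIdeal R).map (algebraMap R O) := by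
  have hinj : Function.Injective (algebraMap R O) := FaithfulSMul.algebraMap_injective R O
  have huniq := (totRam_unique P h).2
  have hmax : ∀ Q : Ideal O, Q.IsMaximal → Q = P := fun Q hQ => huniq Q hQ.isPrime
    ⟨(IsLocalRing.eq_maximalIdeal (Ideal.isMaximal_comap_of_isIntegral_of_isMaximal Q)).symm⟩
  obtain ⟨Q, hQ⟩ := Ideal.exists_maximal O
  have hPmax : P.IsMaximal := hmax Q hQ ▸ hQ
  have : IsLocalRing O := .of_unique_max_ideal ⟨P, hPmax, hmax⟩
  have hP : P = maximalIdeal O := IsLocalRing.eq_maximalIdeal hPmax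
  have hmO : (maximalIdeal R).map (algebraMap R O) ≠ ⊥ := by
    rw [Ne, Ideal.map_eq_bot_iff_of_injective hinj]
    exact IsDiscreteValuationRing.not_a_field R
  have hnf : ¬ IsField O := by
    intro hf
    have hle : (maximalIdeal R).map (algebraMap R O) ≤ P :=
      Ideal.map_le_iff_le_comap.2 (Ideal.LiesOver.over (p := maximalIdeal R) (P := P)).le
    rw [hP, (IsLocalRing.isField_iff_maximalIdeal_eq.1 hf)] at hle
    exact hmO (le_bot_iff.1 hle)
  have tf := IsDiscreteValuationRing.TFAE O hnf
  have hdvr : IsDiscreteValuationRing O := (tf.out 0 2 rfl rfl).2 inferInstance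
  have hsp : maximalIdeal O = Ideal.span {ϖ} :=
    (IsDiscreteValuationRing.irreducible_iff_uniformizer ϖ).1 hϖ
  refine ⟨hP.trans hsp, ?_⟩
  obtain ⟨j, hj⟩ := (tf.out 0 6 rfl rfl).1 hdvr _ hmO
  refine ⟨j, ?_⟩
  rw [hj, hsp]
  exact Ideal.pow_mem_pow (Ideal.mem_span_singleton_self ϖ) j

theorem totRam_aeval_surjective (P : Ideal O) [P.IsPrime] [P.LiesOver (maximalIdeal R)]
    (h : P.ramificationIdx R = Module.finrank R O) {ϖ : O} (hϖ : Irreducible ϖ) :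
    Function.Surjective (aeval (R := R) ϖ) := by
  obtain ⟨hP, j, hj⟩ := totRam_span P h hϖ
  have hPmax : P.IsMaximal := Ideal.isMaximal_of_isIntegral_of_isMaximal_comap (R := R) P (by
    have hov := Ideal.LiesOver.over (p := maximalIdeal R) (P := P)
    rw [← Ideal.under_def, ← hov]
    infer_instance)
  have hf := (totRam_unique P h).1
  rw [Ideal.inertiaDeg_eq_of_isMaximal (maximalIdeal R) P] at hf
  let _ : Field (R ⧸ maximalIdeal R) := Ideal.Quotient.field _
  have hres : ∀ z : O, ∃ c : R, z - algebraMap R O c ∈ P := by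
    intro z
    obtain ⟨c, hc⟩ := (finrank_eq_one_iff_of_nonzero' (1 : O ⧸ P) one_ne_zero).1 hf
      (Ideal.Quotient.mk P z)
    obtain ⟨c, rfl⟩ := Ideal.Quotient.mk_surjective c
    refine ⟨c, ?_⟩
    rw [← Ideal.Quotient.mk_eq_mk_iff_sub_mem, ← hc]
    rw [Algebra.smul_def, mul_one]
    rfl
  have hstep : ∀ i : ℕ, ∀ z : O, ∃ g : R[X], ∃ w : O, z = aeval ϖ g + ϖ ^ i * w := by
    intro i
    induction i with
    | zero => intro z; exact ⟨0, z, by simp⟩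
    | succ i ih =>
      intro z
      obtain ⟨c, hc⟩ := hres z
      rw [hP, Ideal.mem_span_singleton] at hc
      obtain ⟨y, hy⟩ := hc
      obtain ⟨g, w, hw⟩ := ih y
      refine ⟨C c + X * g, w, ?_⟩
      rw [sub_eq_iff_eq_add.1 hy, hw]
      simp only [map_add, aeval_C, map_mul, aeval_X]
      ring
  have htop : (⊤ : Submodule R O) ≤ LinearMap.range (aeval (R := R) ϖ).toLinearMap := by
    refine Submodule.le_of_le_smul_of_le_jacobson_bot (I := maximalIdeal R)
      Module.Finite.fg_top (IsLocalRing.maximalIdeal_le_jacobson _) ?_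
    intro z _
    obtain ⟨g, w, rfl⟩ := hstep j z
    refine Submodule.add_mem_sup ⟨g, rfl⟩ ?_
    rw [Ideal.smul_top_eq_map]
    exact Ideal.mul_mem_right _ _ hj
  intro z
  exact htop (Submodule.mem_top (x := z))

theorem totRam_isDistinguishedAt (P : Ideal O) [P.IsPrime] [P.LiesOver (maximalIdeal R)]
    (h : P.ramificationIdx R = Module.finrank R O) {ϖ : O} (hϖ : Irreducible ϖ) :
    (minpoly R ϖ).IsDistinguishedAt (maximalIdeal R) := by
  have hint : IsIntegral R ϖ := Algebra.IsIntegral.isIntegral ϖ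
  have hmon := minpoly.monic hint
  obtain ⟨-, j, hj⟩ := totRam_span P h hϖ
  obtain ⟨t, ht⟩ := IsDiscreteValuationRing.exists_irreducible R
  have htm := (IsDiscreteValuationRing.irreducible_iff_uniformizer t).1 ht
  rw [htm, Ideal.map_span, Set.image_singleton, Ideal.mem_span_singleton] at hj
  obtain ⟨z, hz⟩ := hj
  obtain ⟨g, rfl⟩ := totRam_aeval_surjective P h hϖ z
  have hdvd : minpoly R ϖ ∣ X ^ j - C t * g :=
    minpoly.isIntegrallyClosed_dvd hint (by simp [hz])
  have hdvd' : (minpoly R ϖ).map (residue R) ∣ X ^ j := by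
    have := Polynomial.map_dvd (residue R) hdvd
    have ht0 : residue R t = 0 := by
      rw [IsLocalRing.residue_eq_zero_iff, htm]; exact Ideal.mem_span_singleton_self t
    simpa [ht0] using this
  obtain ⟨i, -, hi⟩ := (dvd_prime_pow prime_X j).1 hdvd'
  have heq := eq_of_monic_of_associated (hmon.map _) (monic_X_pow i) hi
  have hi' : (minpoly R ϖ).natDegree = i := by
    have := congrArg natDegree heq
    rwa [hmon.natDegree_map, natDegree_X_pow] at this
  refine { mem := ?_, monic := hmon }
  intro n hn
  rw [← IsLocalRing.residue_eq_zero_iff, ← coeff_map, heq, coeff_X_pow, if_neg (by omega)]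
end TotallyRamified

section Setup

variable (p : ℕ) [Fact p.Prime] (k : Type*) [Field k]

/-- The ring of Witt vectors `W = W(k)`. -/
abbrev W : Type _ := WittVector p k

/-- The field `K₀ = Frac W`. -/
abbrev K₀ : Type _ := FractionRing (W p k)

/-- The ring `𝔖 = W⟦u⟧`; the variable `u` is `PowerSeries.X`. -/
abbrev S : Type _ := PowerSeries (W p k)

/-- The Frobenius of `𝔖`: `∑ aⱼ uʲ ↦ ∑ φ_W(aⱼ) u^(p j)`. -/
noncomputable def frob : S p k →+* S p k :=
  (PowerSeries.expand p (Fact.out : p.Prime).ne_zero).toRingHom.comp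
    (PowerSeries.map (WittVector.frobenius : W p k →+* W p k))

theorem frob_X : frob p k PowerSeries.X = PowerSeries.X ^ p := by
  simp [frob]

variable [CharP k p]

theorem charZero_W : CharZero (W p k) := by
  obtain ⟨q, hq⟩ := CharP.exists (W p k)
  rcases CharP.char_is_prime_or_zero (W p k) q with h | h
  · exfalso
    have h0 : ((q : ℕ) : W p k) = 0 := CharP.cast_eq_zero _ q
    have h1 : ((q : ℕ) : k) = 0 := by
      rw [← map_natCast (WittVector.constantCoeff (p := p) (R := k)), h0, map_zero]
    have h2 : p ∣ q := (CharP.cast_eq_zero_iff k p q).1 h1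
    rw [← (Nat.prime_dvd_prime_iff_eq Fact.out h).1 h2] at h0
    exact WittVector.p_nonzero p k h0
  · subst h
    exact CharP.charP_to_charZero _

variable [PerfectRing k p] (K : Type*) [Field K] [Algebra (W p k) K] [Algebra (K₀ p k) K]
  [IsScalarTower (W p k) (K₀ p k) K]

/-- The ring of integers of `K`: the integral closure of `W` in `K`. -/
abbrev OK : Type _ := integralClosure (W p k) K

/-- `K / K₀` is totally ramified: the ramification index of a prime of `𝒪_K` above the maximal
ideal of `W` is the full degree `[K : K₀]`. -/
def IsTotallyRamified : Prop :=
  ∃ P : Ideal (OK p k K), P.IsPrime ∧ P.LiesOver (maximalIdeal (W p k)) ∧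
    P.ramificationIdx (W p k) = Module.finrank (K₀ p k) K

variable {p k K}

/-- `E`, the minimal polynomial over `W` of `π`, as an element of `𝔖`. -/
noncomputable abbrev eisenstein (π : OK p k K) : S p k :=
  ((minpoly (W p k) π : (W p k)[X]) : PowerSeries (W p k))

section
variable [FiniteDimensional (K₀ p k) K]

theorem eisenstein_facts (hK : IsTotallyRamified p k K) {π : OK p k K} (hπ : Irreducible π) :
    Function.Surjective (aeval (R := W p k) π) ∧
    RingHom.ker (aeval (R := W p k) π) = Ideal.span {minpoly (W p k) π} ∧
    (minpoly (W p k) π).IsDistinguishedAt (Ideal.span {(p : W p k)}) := by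
  have := charZero_W p k
  have : CharZero (K₀ p k) := charZero_of_injective_algebraMap
    (IsFractionRing.injective (W p k) (K₀ p k))
  have : Module.Finite (W p k) (OK p k K) := IsIntegralClosure.finite (W p k) (K₀ p k) K _
  have : IsDedekindDomain (OK p k K) := IsIntegralClosure.isDedekindDomain (W p k) (K₀ p k) K _
  have : FaithfulSMul (W p k) K := FaithfulSMul.trans (W p k) (K₀ p k) K
  have hrank : Module.finrank (W p k) (OK p k K) = Module.finrank (K₀ p k) K :=
    IsIntegralClosure.rank (W p k) (K₀ p k) K _
  obtain ⟨P, hP, hP', he⟩ := hK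
  rw [← hrank] at he
  have hpm : maximalIdeal (W p k) = Ideal.span {(p : W p k)} :=
    (IsDiscreteValuationRing.irreducible_iff_uniformizer _).1 (WittVector.irreducible p)
  exact ⟨totRam_aeval_surjective P he hπ,
    minpoly.ker_eval (Algebra.IsIntegral.isIntegral π),
    hpm ▸ totRam_isDistinguishedAt P he hπ⟩

/-- The identification `𝒪_K ≃ 𝔖/E`, inverse to `u ↦ π`. -/
noncomputable def nat (hK : IsTotallyRamified p k K) {π : OK p k K} (hπ : Irreducible π) :
    OK p k K ≃ₐ[W p k] S p k ⧸ Ideal.span {eisenstein π} :=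
  ((Ideal.quotientEquivAlgOfEq (W p k) (eisenstein_facts hK hπ).2.1.symm).trans
    (Ideal.quotientKerAlgEquivOfSurjective (eisenstein_facts hK hπ).1)).symm.trans
    (eisenstein_facts hK hπ).2.2.algEquivQuotient

theorem nat_uniformizer (hK : IsTotallyRamified p k K) {π : OK p k K} (hπ : Irreducible π) :
    nat hK hπ π = Ideal.Quotient.mk _ PowerSeries.X := by
  have h : ((Ideal.quotientEquivAlgOfEq (W p k) (eisenstein_facts hK hπ).2.1.symm).trans
      (Ideal.quotientKerAlgEquivOfSurjective (eisenstein_facts hK hπ).1)).symm π =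
      Ideal.Quotient.mk _ X := by
    rw [AlgEquiv.symm_apply_eq]
    change π = aeval π X
    simp
  refine (congrArg (eisenstein_facts hK hπ).2.2.algEquivQuotient h).trans ?_
  simp
end

end Setup

section Modules

open scoped TensorProduct

variable (p : ℕ) [Fact p.Prime] (k : Type*) [Field k] [CharP k p] [PerfectRing k p]

/-- A copy of `𝔖`, regarded as an `𝔖`-algebra through the `n`-th iterate of the Frobenius. -/
def TwistRing (_n : ℕ) : Type _ := S p k

noncomputable instance (n : ℕ) : CommRing (TwistRing p k n) :=
  inferInstanceAs (CommRing (S p k))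

noncomputable instance (n : ℕ) : Algebra (S p k) (TwistRing p k n) :=
  RingHom.toAlgebra (S := TwistRing p k n) (frob p k ^ n)

/-- The Frobenius twist `𝔐⁽ⁿ⁾ = 𝔐 ⊗_{𝔖, φⁿ} 𝔖`. -/
def Twist (n : ℕ) (M : Type*) [AddCommGroup M] [Module (S p k) M] : Type _ :=
  TwistRing p k n ⊗[S p k] M

variable (n : ℕ) (M : Type*) [AddCommGroup M] [Module (S p k) M]

noncomputable instance : AddCommGroup (Twist p k n M) :=
  inferInstanceAs (AddCommGroup (TwistRing p k n ⊗[S p k] M))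

/-- `𝔖` acts on `𝔐⁽ⁿ⁾` through the new factor `𝔖`: `s • (t ⊗ m) = (s t) ⊗ m`. -/
noncomputable instance : Module (S p k) (Twist p k n M) :=
  inferInstanceAs (Module (TwistRing p k n) (TwistRing p k n ⊗[S p k] M))

/-- Every element of `M` is killed by a power of `u`. -/
def IsUPowTorsion : Prop :=
  ∀ m : M, ∃ r : ℕ, (PowerSeries.X ^ r : S p k) • m = 0

/-- The number `α(𝔐)`, characterised by `Ann(𝔐) + (p) = (p, u^α)`. -/
noncomputable def alpha : ℕ :=
  sInf {α : ℕ | Module.annihilator (S p k) M ⊔ Ideal.span {(p : S p k)} =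
    Ideal.span {(p : S p k), PowerSeries.X ^ α}}

variable {p k}

/-- A quasi-filtered Breuil--Kisin module of height `i ≥ 1` (for the element `E` of `𝔖`),
with underlying modules `𝔐` (finitely generated, as for every Breuil--Kisin module) and `𝔑`. -/
structure QuasiFilteredBKModule (E : S p k) (i : ℕ) (M N : Type*)
    [AddCommGroup M] [Module (S p k) M] [AddCommGroup N] [Module (S p k) N] where
  one_le_height : 1 ≤ i
  finite : Module.Finite (S p k) M
  f : Twist p k 1 M →ₗ[S p k] N
  g : N →ₗ[S p k] Twist p k 1 M
  h : N →ₗ[S p k] M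
  h' : M →ₗ[S p k] N
  h_injective : Function.Injective h
  g_comp_f : g ∘ₗ f = E ^ (i - 1) • LinearMap.id
  f_comp_g : f ∘ₗ g = E ^ (i - 1) • LinearMap.id
  h'_comp_h : h' ∘ₗ h = E • LinearMap.id
  h_comp_h' : h ∘ₗ h' = E • LinearMap.id

variable {K : Type*} [Field K] [Algebra (W p k) K] [Algebra (K₀ p k) K]
  [IsScalarTower (W p k) (K₀ p k) K] [FiniteDimensional (K₀ p k) K]

/-- The length over `𝒪_K` of the `E`-torsion `T[E]` of an `𝔖`-module `T`. Here `T[E]` is a module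
over `𝔖/E`, hence over `𝒪_K` through the identification `𝒪_K ≃ 𝔖/E`. -/
noncomputable def lengthETorsion (hK : IsTotallyRamified p k K) {π : OK p k K}
    (hπ : Irreducible π) (T : Type*) [AddCommGroup T] [Module (S p k) T] : ℕ∞ :=
  letI : Module (OK p k K) (Submodule.torsionBy (S p k) T (eisenstein π)) :=
    Module.compHom _ (nat hK hπ : OK p k K →+* S p k ⧸ Ideal.span {eisenstein π})
  Module.length (OK p k K) (Submodule.torsionBy (S p k) T (eisenstein π))

end Modules

/-- The integer `a = ⌈log_p (e / (p - 1))⌉`. It is non-negative as `e ≥ 1`. -/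
noncomputable def twistBound (p e : ℕ) : ℕ :=
  ⌈Real.logb p ((e : ℝ) / ((p : ℝ) - 1))⌉₊

end BreuilKisin

/-! The crux is that `p` kills `M` (`p_mem_annihilator`). The rest is then a computation over `k⟦u⟧
= 𝔖/p`, a discrete valuation ring: `M` is a finite sum of cyclic modules `k⟦u⟧/u^(a j)`, its `n`-th
twist is the sum of the `k⟦u⟧/u^(pⁿ a j)`, and `E` acts as `u^e`. The `E`-torsion of a summand grows
with the exponent, has length at most `e`, and has length at least `1` if the exponent is positive.
Both inequalities follow summand by summand.

To see that `p` kills `M`, write `J = Ann M` and `J' = Ann M⁽¹⁾`. Three facts relate them: `E J ⊆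
J'`, since `J` kills `N ⊆ M` and `g ∘ f = E^(i-1)` factors through `N`; `φ(J) ⊆ J'`; and the
components of an element of `J'` in the basis `1, u, …, u^(p-1)` of `𝔖` over `φ(𝔖)` lie in `J`. Take
`x = u^α - p c` in `J` and `E = u^e + p v` with `v` a unit. Reading the components of `E x` modulo
`p` gives `p α ≤ e + α`, so `α < p` because `e < p (p - 1)`. With `d = e + α - p α`, the leading
terms cancel in `E x - u^d φ(x) = p w`, an element of `J'`. Every component of `w` multiplied by `p`
therefore lies in `J`, so one unit component suffices; the coefficients of `w` at `α` and `d` show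
that there is one, provided `p α ≠ e`, that is `α ≠ d`. -/

namespace BreuilKisin

open IsLocalRing Polynomial

set_option linter.unusedSectionVars false

/-! ### Reduction modulo `p`, from `𝔖` to `k⟦u⟧` -/

section Reduction

variable (p : ℕ) [Fact p.Prime] (k : Type*) [Field k]

/-- Reduction modulo `p`, as a map `𝔖 → k⟦u⟧`. -/
noncomputable def red : S p k →+* PowerSeries k :=
  PowerSeries.map (WittVector.constantCoeff : W p k →+* k)

variable {p k}

theorem coeff_red (n : ℕ) (s : S p k) :
    PowerSeries.coeff n (red p k s) = WittVector.constantCoeff (PowerSeries.coeff n s) := by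
  simp [red]

@[simp]
theorem red_X : red p k PowerSeries.X = PowerSeries.X := by
  simp [red]

theorem red_surjective : Function.Surjective (red p k) := by
  intro g
  choose f hf using fun n =>
    WittVector.constantCoeff_surjective (p := p) (R := k) (PowerSeries.coeff n g)
  refine ⟨PowerSeries.mk f, ?_⟩
  ext n
  rw [coeff_red, PowerSeries.coeff_mk, hf]

variable [CharP k p]

@[simp]
theorem red_p : red p k (p : S p k) = 0 := by
  rw [map_natCast, ← map_natCast (PowerSeries.C (R := k)), CharP.cast_eq_zero, map_zero]

theorem constantCoeff_frobenius (x : W p k) :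
    WittVector.constantCoeff (WittVector.frobenius x) = WittVector.constantCoeff x ^ p := by
  simp [WittVector.constantCoeff_apply, WittVector.coeff_frobenius_charP]

theorem red_frob_coeff_mul (s : S p k) (n : ℕ) :
    PowerSeries.coeff (p * n) (red p k (frob p k s)) = PowerSeries.coeff n (red p k s) ^ p := by
  rw [coeff_red, coeff_red, ← constantCoeff_frobenius]
  simp [frob, PowerSeries.coeff_expand_mul]

theorem red_frob_coeff_of_not_dvd (s : S p k) {n : ℕ} (h : ¬ p ∣ n) :
    PowerSeries.coeff n (red p k (frob p k s)) = 0 := by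
  rw [coeff_red]
  simp [frob, PowerSeries.coeff_expand_of_not_dvd _ _ _ h]

variable [PerfectRing k p]

theorem ker_red : RingHom.ker (red p k) = Ideal.span {(p : S p k)} := by
  apply le_antisymm
  · intro s hs
    have h : ∀ n, ∃ c : W p k, PowerSeries.coeff n s = p * c := by
      intro n
      rw [← dvd_def, ← Ideal.mem_span_singleton, ← WittVector.ker_constantCoeff,
        RingHom.mem_ker, ← coeff_red, RingHom.mem_ker.1 hs, map_zero]
    choose c hc using h
    rw [Ideal.mem_span_singleton]
    refine ⟨PowerSeries.mk c, ?_⟩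
    ext1 n
    rw [hc, ← map_natCast (PowerSeries.C (R := W p k)), PowerSeries.coeff_C_mul,
      PowerSeries.coeff_mk]
  · rw [Ideal.span_singleton_le_iff_mem, RingHom.mem_ker, red_p]

theorem mem_span_p_sup_iff {a : ℕ} {s : S p k} :
    s ∈ Ideal.span {(p : S p k)} ⊔ Ideal.span {(PowerSeries.X : S p k) ^ a} ↔
      (PowerSeries.X : PowerSeries k) ^ a ∣ red p k s := by
  rw [← ker_red, sup_comm, ← Ideal.comap_map_of_surjective' (red p k) red_surjective, Ideal.mem_comap,
    Ideal.map_span, Set.image_singleton, map_pow, red_X, Ideal.mem_span_singleton]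

theorem isUnit_iff_red {s : S p k} :
    IsUnit s ↔ PowerSeries.coeff 0 (red p k s) ≠ 0 := by
  rw [PowerSeries.isUnit_iff_constantCoeff, coeff_red, PowerSeries.coeff_zero_eq_constantCoeff_apply]
  exact ⟨fun h => (h.map (WittVector.constantCoeff : W p k →+* k)).ne_zero,
    fun h => WittVector.isUnit_of_coeff_zero_ne_zero _ h⟩

end Reduction

/-! ### The shape of the Eisenstein polynomial -/

section Eisenstein

variable {p : ℕ} [Fact p.Prime] {k : Type*} [Field k] [CharP k p] [PerfectRing k p]
  {K : Type*} [Field K] [Algebra (W p k) K] [Algebra (K₀ p k) K]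
  [IsScalarTower (W p k) (K₀ p k) K] [FiniteDimensional (K₀ p k) K]

/-- Both sides are the `W`-rank of `𝒪_K`, since `𝒪_K` is `W[X]` modulo the minimal polynomial. -/
theorem natDegree_minpoly_uniformizer (hK : IsTotallyRamified p k K) {π : OK p k K}
    (hπ : Irreducible π) :
    (minpoly (W p k) π).natDegree = Module.finrank (K₀ p k) K := by
  have := charZero_W p k
  have : CharZero (K₀ p k) := charZero_of_injective_algebraMap
    (IsFractionRing.injective (W p k) (K₀ p k))
  have : FaithfulSMul (W p k) K := FaithfulSMul.trans (W p k) (K₀ p k) K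
  have hrank : Module.finrank (W p k) (OK p k K) = Module.finrank (K₀ p k) K :=
    IsIntegralClosure.rank (W p k) (K₀ p k) K _
  obtain ⟨hs, hker, hd⟩ := eisenstein_facts hK hπ
  rw [← hrank, ← finrank_quotient_span_eq_natDegree' hd.monic]
  exact LinearEquiv.finrank_eq ((Ideal.quotientEquivAlgOfEq (W p k) hker.symm).trans
    (Ideal.quotientKerAlgEquivOfSurjective hs)).toLinearEquiv

theorem uniformizer_dvd_p (hK : IsTotallyRamified p k K) {π : OK p k K}
    (hπ : Irreducible π) : π ∣ (p : OK p k K) := by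
  have := charZero_W p k
  have : CharZero (K₀ p k) := charZero_of_injective_algebraMap
    (IsFractionRing.injective (W p k) (K₀ p k))
  have : Module.Finite (W p k) (OK p k K) := IsIntegralClosure.finite (W p k) (K₀ p k) K _
  have : IsDedekindDomain (OK p k K) := IsIntegralClosure.isDedekindDomain (W p k) (K₀ p k) K _
  have : FaithfulSMul (W p k) K := FaithfulSMul.trans (W p k) (K₀ p k) K
  have hrank : Module.finrank (W p k) (OK p k K) = Module.finrank (K₀ p k) K :=
    IsIntegralClosure.rank (W p k) (K₀ p k) K _
  obtain ⟨P, hP, hP', he⟩ := hK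
  rw [← hrank] at he
  rw [← Ideal.mem_span_singleton, ← (totRam_span P he hπ).1]
  have hpm : (p : W p k) ∈ maximalIdeal (W p k) := by
    rw [(IsDiscreteValuationRing.irreducible_iff_uniformizer _).1 (WittVector.irreducible p)]
    exact Ideal.mem_span_singleton_self _
  rw [hP'.over, Ideal.under_def, Ideal.mem_comap, map_natCast] at hpm
  exact hpm

/-- The lower coefficients of the minimal polynomial are divisible by `p`, which gives `v`. For `v`
to be a unit the constant term must be exactly divisible by `p`; this comes from `π ∣ p`. -/
theorem exists_eisenstein_eq (hK : IsTotallyRamified p k K) {π : OK p k K}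
    (hπ : Irreducible π) :
    ∃ v : S p k, IsUnit v ∧
      eisenstein π = PowerSeries.X ^ Module.finrank (K₀ p k) K + (p : S p k) * v := by
  obtain ⟨hs, hker, hd⟩ := eisenstein_facts hK hπ
  have hdeg := natDegree_minpoly_uniformizer hK hπ
  set F := minpoly (W p k) π with hF
  set e := Module.finrank (K₀ p k) K with he
  have hepos : 0 < e := Module.finrank_pos
  have hmem : eisenstein π - PowerSeries.X ^ e ∈ RingHom.ker (red p k) := by
    rw [RingHom.mem_ker]
    ext n
    rw [coeff_red, map_sub, Polynomial.coeff_coe, PowerSeries.coeff_X_pow, map_zero, ← hF]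
    split_ifs with h
    · rw [h, ← hdeg, coeff_natDegree, hd.monic.leadingCoeff, sub_self, map_zero]
    · rw [sub_zero]
      rcases lt_or_gt_of_ne h with h' | h'
      · have := hd.mem (by rw [hdeg]; exact h')
        rwa [← WittVector.ker_constantCoeff, RingHom.mem_ker] at this
      · rw [coeff_eq_zero_of_natDegree_lt (by rw [hdeg]; exact h'), map_zero]
  rw [ker_red, Ideal.mem_span_singleton] at hmem
  obtain ⟨v, hv⟩ := hmem
  refine ⟨v, ?_, by rw [← hv]; ring⟩
  -- Writing `p = π g(π)`, the minimal polynomial `F` divides `p - X g`. Constant terms give `p = p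
  -- v(0) q(0)`, and cancelling `p` inverts `v(0)`.
  obtain ⟨y, hy⟩ := uniformizer_dvd_p hK hπ
  obtain ⟨g, rfl⟩ := hs y
  have hdvd : F ∣ (p : (W p k)[X]) - X * g := by
    rw [← Ideal.mem_span_singleton, ← hker, RingHom.mem_ker]
    simp [hy]
  obtain ⟨q, hq⟩ := hdvd
  have h0 := congrArg (fun f : (W p k)[X] => f.coeff 0) hq
  have hF0 : F.coeff 0 = p * PowerSeries.constantCoeff v := by
    have := congrArg PowerSeries.constantCoeff hv
    rwa [map_sub, map_mul, map_natCast, map_pow, PowerSeries.constantCoeff_X, zero_pow hepos.ne',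
      sub_zero, Polynomial.constantCoeff_coe] at this
  simp only [coeff_sub, mul_coeff_zero, coeff_X_zero, zero_mul, sub_zero, hF0,
    coeff_natCast_ite, if_true] at h0
  rw [PowerSeries.isUnit_iff_constantCoeff]
  have hp0 : (p : W p k) ≠ 0 := WittVector.p_nonzero p k
  refine IsUnit.of_mul_eq_one (q.coeff 0) (mul_left_cancel₀ hp0 ?_)
  rw [mul_one, ← mul_assoc, ← h0]

end Eisenstein

/-! ### Components along the Frobenius, and annihilators of the twist -/

section FrobeniusComponents

open scoped TensorProduct

variable {p : ℕ} [Fact p.Prime] {k : Type*} [Field k] [CharP k p] [PerfectRing k p]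

/-- The component of index `i` with respect to the basis `1, u, …, u ^ (p - 1)` of `𝔖` over
itself through the Frobenius. -/
noncomputable def frobComponent (i : ℕ) (s : S p k) : S p k :=
  PowerSeries.mk fun n => (WittVector.frobeniusEquiv p k).symm (PowerSeries.coeff (p * n + i) s)

theorem frobenius_coeff_frobComponent (i n : ℕ) (s : S p k) :
    WittVector.frobenius (PowerSeries.coeff n (frobComponent i s)) =
      PowerSeries.coeff (p * n + i) s := by
  rw [frobComponent, PowerSeries.coeff_mk]
  exact (WittVector.frobeniusEquiv p k).apply_symm_apply _

theorem coeff_red_frobComponent (i n : ℕ) (s : S p k) :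
    PowerSeries.coeff n (red p k (frobComponent i s)) ^ p =
      PowerSeries.coeff (p * n + i) (red p k s) := by
  rw [coeff_red, coeff_red, ← constantCoeff_frobenius, frobenius_coeff_frobComponent]

theorem frobComponent_add (i : ℕ) (s t : S p k) :
    frobComponent i (s + t) = frobComponent i s + frobComponent i t := by
  ext1 n
  simp [frobComponent]

/-- Linearity over the Frobenius: `φ(a)` only involves powers of `u^p`, so multiplying by it
preserves the exponent class modulo `p`. -/
theorem frobComponent_frob_mul {i : ℕ} (hi : i < p) (a t : S p k) :
    frobComponent i (frob p k a * t) = a * frobComponent i t := by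
  have hp : 0 < p := (Fact.out : p.Prime).pos
  ext1 n
  apply (WittVector.frobeniusEquiv p k).injective
  change WittVector.frobenius _ = WittVector.frobenius _
  rw [frobenius_coeff_frobComponent, PowerSeries.coeff_mul, PowerSeries.coeff_mul, map_sum]
  symm
  -- Only pairs with first index `p x` contribute to the coefficient of `u^(p n + i)`. As `i < p`,
  -- such a pair has `x ≤ n`, so it comes from the pair `(x, n - x)`.
  refine Finset.sum_of_injOn (fun x => (p * x.1, p * x.2 + i)) ?_ ?_ ?_ ?_
  · rintro ⟨x, y⟩ - ⟨x', y'⟩ - h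
    simp only [Prod.mk.injEq, Nat.add_right_cancel_iff, mul_eq_mul_left_iff, hp.ne', or_false] at h
    simp [h]
  · rintro ⟨x, y⟩ h
    simp only [Finset.mem_coe,
      Finset.HasAntidiagonal.mem_antidiagonal] at h ⊢
    rw [← h]; ring
  · rintro ⟨x, y⟩ h hn
    rw [Finset.HasAntidiagonal.mem_antidiagonal] at h
    by_cases hx : p ∣ x
    · obtain ⟨x, rfl⟩ := hx
      refine absurd ⟨(x, n - x), ?_, ?_⟩ hn
      · have : p * x < p * (n + 1) := by rw [mul_add, mul_one]; omega
        have := Nat.lt_of_mul_lt_mul_left this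
        simp only [Finset.mem_coe, Finset.HasAntidiagonal.mem_antidiagonal]
        omega
      · have : p * x < p * (n + 1) := by rw [mul_add, mul_one]; omega
        have := Nat.lt_of_mul_lt_mul_left this
        have h2 : p * (n - x) + p * x = p * n := by rw [← mul_add]; congr 1; omega
        simp only [Prod.mk.injEq, true_and]
        omega
    · simp [frob, PowerSeries.coeff_expand_of_not_dvd _ _ _ hx]
  · rintro ⟨x, y⟩ -
    simp only
    rw [map_mul, frobenius_coeff_frobComponent]
    simp [frob, PowerSeries.coeff_expand_mul]

/-- `frobComponent` as a linear map from `𝔖`, regarded as a module through the Frobenius. -/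
noncomputable def frobComponentLinear {i : ℕ} (hi : i < p) : TwistRing p k 1 →ₗ[S p k] S p k where
  toFun := frobComponent (p := p) (k := k) i
  map_add' := frobComponent_add i
  map_smul' a t := by
    rw [Algebra.smul_def]
    exact frobComponent_frob_mul hi a t

variable {M : Type*} [AddCommGroup M] [Module (S p k) M]

/-- Since `s` kills `1 ⊗ m`, the tensor `s ⊗ m` vanishes. The component map is `𝔖`-linear for the
Frobenius structure, so tensoring it with `M` sends this tensor to the component of `s` times `m`.
-/
theorem frobComponent_mem_annihilator {s : S p k}
    (hs : s ∈ Module.annihilator (S p k) (Twist p k 1 M)) {i : ℕ} (hi : i < p) :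
    frobComponent i s ∈ Module.annihilator (S p k) M := by
  rw [Module.mem_annihilator] at hs ⊢
  intro m
  let s' : TwistRing p k 1 := s
  have h : s' ⊗ₜ[S p k] m = 0 := by
    have := hs ((1 : TwistRing p k 1) ⊗ₜ[S p k] m)
    change (s' * 1) ⊗ₜ[S p k] m = 0 at this
    rwa [mul_one] at this
  have h2 := congrArg (fun z => TensorProduct.lid (S p k) M
    ((frobComponentLinear hi).rTensor M z)) h
  simp only [LinearMap.rTensor_tmul, TensorProduct.lid_tmul, map_zero] at h2
  exact h2

theorem frob_mem_annihilator {s : S p k} (hs : s ∈ Module.annihilator (S p k) M) :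
    frob p k s ∈ Module.annihilator (S p k) (Twist p k 1 M) := by
  rw [Module.mem_annihilator] at hs ⊢
  intro z
  change TwistRing p k 1 ⊗[S p k] M at z
  induction z using TensorProduct.induction_on with
  | zero => exact smul_zero (A := Twist p k 1 M) _
  | add x y hx hy => exact (smul_add (A := Twist p k 1 M) _ x y).trans (by rw [hx, hy, add_zero])
  | tmul t m =>
    change (s • t) ⊗ₜ[S p k] m = 0
    rw [TensorProduct.smul_tmul, hs, TensorProduct.tmul_zero]

end FrobeniusComponents

/-! ### The module is killed by `p` -/

section KilledByP

variable {p : ℕ} [Fact p.Prime] {k : Type*} [Field k] [CharP k p] [PerfectRing k p]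
  {M : Type*} [AddCommGroup M] [Module (S p k) M]

theorem IsUPowTorsion.exists_pow_mem_annihilator [Module.Finite (S p k) M]
    (hu : IsUPowTorsion p k M) :
    ∃ r : ℕ, (PowerSeries.X ^ r : S p k) ∈ Module.annihilator (S p k) M := by
  obtain ⟨s, hs⟩ := Module.Finite.fg_top (R := S p k) (M := M)
  choose r hr using hu
  refine ⟨s.sup r, ?_⟩
  rw [Module.mem_annihilator]
  intro m
  have hm : m ∈ Submodule.span (S p k) (s : Set M) := hs ▸ Submodule.mem_top
  induction hm using Submodule.span_induction with
  | mem x hx =>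
    obtain ⟨d, hd⟩ := Nat.exists_eq_add_of_le' (Finset.le_sup (f := r) hx)
    rw [hd, pow_add, mul_smul, hr, smul_zero]
  | zero => rw [smul_zero]
  | add x y _ _ hx hy => rw [smul_add, hx, hy, add_zero]
  | smul a x _ hx => rw [smul_comm, hx, smul_zero]

/-- The infimum defining `alpha` is attained as soon as some exponent qualifies. One does: the image
of the annihilator in `k⟦u⟧` contains a power of `u`, hence is a nonzero ideal of a discrete
valuation ring. -/
theorem annihilator_sup_eq_span_alpha [Module.Finite (S p k) M] (hu : IsUPowTorsion p k M) :
    Module.annihilator (S p k) M ⊔ Ideal.span {(p : S p k)} =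
      Ideal.span {(p : S p k), PowerSeries.X ^ alpha p k M} := by
  refine Nat.sInf_mem (s := {α : ℕ | Module.annihilator (S p k) M ⊔ Ideal.span {(p : S p k)} =
    Ideal.span {(p : S p k), PowerSeries.X ^ α}}) ?_
  obtain ⟨r, hr⟩ := hu.exists_pow_mem_annihilator
  have hne : (Module.annihilator (S p k) M).map (red p k) ≠ ⊥ := by
    intro h
    have := Ideal.mem_map_of_mem (red p k) hr
    rw [h, Ideal.mem_bot, map_pow, red_X] at this
    exact pow_ne_zero r PowerSeries.X_ne_zero this
  obtain ⟨a, ha⟩ := IsDiscreteValuationRing.ideal_eq_span_pow_irreducible hne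
    PowerSeries.X_irreducible
  refine ⟨a, ?_⟩
  rw [Set.mem_ofPred_eq, ← ker_red, ← Ideal.comap_map_of_surjective' (red p k) red_surjective, ha]
  ext s
  rw [Ideal.span_insert, mem_span_p_sup_iff, Ideal.mem_comap, Ideal.mem_span_singleton]

theorem X_pow_alpha_dvd_red [Module.Finite (S p k) M] (hu : IsUPowTorsion p k M) {s : S p k}
    (hs : s ∈ Module.annihilator (S p k) M) :
    (PowerSeries.X : PowerSeries k) ^ alpha p k M ∣ red p k s := by
  rw [← mem_span_p_sup_iff, ← Ideal.span_insert, ← annihilator_sup_eq_span_alpha hu]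
  exact Ideal.mem_sup_left hs

theorem exists_X_pow_alpha_sub_mem [Module.Finite (S p k) M] (hu : IsUPowTorsion p k M) :
    ∃ c : S p k, PowerSeries.X ^ alpha p k M - (p : S p k) * c ∈ Module.annihilator (S p k) M := by
  have h : (PowerSeries.X ^ alpha p k M : S p k) ∈
      Module.annihilator (S p k) M ⊔ Ideal.span {(p : S p k)} := by
    rw [annihilator_sup_eq_span_alpha hu]
    exact Ideal.subset_span (by simp)
  obtain ⟨x, hx, y, hy, hxy⟩ := Submodule.mem_sup.1 h
  obtain ⟨c, rfl⟩ := Ideal.mem_span_singleton.1 hy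
  exact ⟨c, by rwa [← hxy, add_sub_cancel_right]⟩

/-- Injectivity of `h` makes `s` kill `N`, so `E^(i-1) s = g ∘ f ∘ s` vanishes on the twist. The
bound `i ≤ 2` gives `i - 1 ≤ 1`. -/
theorem QuasiFilteredBKModule.mul_mem_annihilator_twist {E : S p k} {i : ℕ} (hi : i ≤ 2)
    {N : Type*} [AddCommGroup N] [Module (S p k) N] (Q : QuasiFilteredBKModule E i M N)
    {s : S p k} (hs : s ∈ Module.annihilator (S p k) M) :
    E * s ∈ Module.annihilator (S p k) (Twist p k 1 M) := by
  rw [Module.mem_annihilator] at hs ⊢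
  intro z
  have hN : ∀ y : N, s • y = 0 := fun y => Q.h_injective (by rw [map_smul, hs, map_zero])
  have h : E ^ (i - 1) • s • z = 0 := by
    have := LinearMap.congr_fun Q.g_comp_f (s • z)
    rw [LinearMap.comp_apply, map_smul, hN, map_zero] at this
    exact this.symm
  have hE : E * s = E ^ (2 - i) * (E ^ (i - 1) * s) := by
    rw [← mul_assoc, ← pow_add, show 2 - i + (i - 1) = 1 by have := Q.one_le_height; omega, pow_one]
  rw [hE, mul_smul, mul_smul, h, smul_zero]

/-- If `E · Ann(M) ⊆ Ann(M⁽¹⁾)`, where `E = u ^ e + p v` with `v` a unit, `p α(M) ≠ e` and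
`e < p (p - 1)`, then the `u`-power torsion module `M` is killed by `p`. -/
theorem p_mem_annihilator [Module.Finite (S p k) M] (hu : IsUPowTorsion p k M) {E v : S p k}
    {e : ℕ} (he : 0 < e) (hv : IsUnit v) (hE : E = PowerSeries.X ^ e + (p : S p k) * v)
    (hmul : ∀ s ∈ Module.annihilator (S p k) M,
      E * s ∈ Module.annihilator (S p k) (Twist p k 1 M))
    (hα : p * alpha p k M ≠ e) (hep : e < p * (p - 1)) :
    (p : S p k) ∈ Module.annihilator (S p k) M := by
  have hp : p.Prime := Fact.out
  obtain ⟨c, hc⟩ := exists_X_pow_alpha_sub_mem hu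
  have hdvd := fun s => X_pow_alpha_dvd_red (M := M) hu (s := s)
  set α := alpha p k M
  have h1 := hmul _ hc
  -- Modulo `p` the element `E x` is `u^(e + α)`. Its component of index `(e + α) % p` has a nonzero
  -- coefficient at `(e + α) / p`, whereas it lies in the annihilator and so is divisible by `u^α`
  -- modulo `p`.
  have hle : p * α ≤ e + α := by
    have hlt : (e + α) % p < p := Nat.mod_lt _ hp.pos
    have h2 := hdvd _ (frobComponent_mem_annihilator h1 hlt)
    by_contra hcon
    have hq : (e + α) / p < α := Nat.div_lt_of_lt_mul (by omega)
    have h3 := PowerSeries.X_pow_dvd_iff.1 h2 _ hq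
    have h4 := coeff_red_frobComponent ((e + α) % p) ((e + α) / p)
      (E * (PowerSeries.X ^ α - (p : S p k) * c))
    have h5 : red p k (E * (PowerSeries.X ^ α - (p : S p k) * c)) = PowerSeries.X ^ (e + α) := by
      simp only [hE, map_mul, map_add, map_sub, red_p, zero_mul, add_zero, sub_zero, map_pow,
        red_X, pow_add]
    rw [h3, Nat.div_add_mod, h5, zero_pow hp.ne_zero, PowerSeries.coeff_X_pow_self] at h4
    exact zero_ne_one h4
  have hαp : α < p := by
    have h5 : (p - 1) * α < (p - 1) * p := by
      rw [mul_comm (p - 1) p, Nat.sub_mul, one_mul]; omega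
    exact Nat.lt_of_mul_lt_mul_left h5
  -- By `hle` the subtraction is not truncated. This `d` makes `u^d φ(u^α)` equal to `u^(e + α)`,
  -- and `w` is what remains of `E x - u^d φ(x)` after division by `p`.
  set d := e + α - p * α with hd
  set w := PowerSeries.X ^ α * v - PowerSeries.X ^ e * c - (p : S p k) * (v * c) +
    PowerSeries.X ^ d * frob p k c with hw
  have hpw : (p : S p k) * w ∈ Module.annihilator (S p k) (Twist p k 1 M) := by
    have h6 := Ideal.sub_mem _ h1 (Ideal.mul_mem_left _ (PowerSeries.X ^ d)
      (frob_mem_annihilator hc))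
    convert h6 using 1
    have h7 : (PowerSeries.X : S p k) ^ d * (PowerSeries.X ^ p) ^ α =
        PowerSeries.X ^ e * PowerSeries.X ^ α := by
      rw [← pow_mul, ← pow_add, ← pow_add]; congr 1; omega
    rw [map_sub, map_mul, map_natCast, map_pow, frob_X, hw, hE]
    linear_combination h7
  -- As `p = φ(p)`, the component of `p w` is `p` times that of `w`, whose constant term modulo `p`
  -- is a `p`-th root of the coefficient at `i`. If that is nonzero the component is a unit and can
  -- be cancelled.
  have key : ∀ i < p, PowerSeries.coeff i (red p k w) ≠ 0 →
      (p : S p k) ∈ Module.annihilator (S p k) M := by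
    intro i hi hne
    have h8 := frobComponent_mem_annihilator hpw hi
    rw [show (p : S p k) = frob p k (p : S p k) from (map_natCast _ _).symm,
      frobComponent_frob_mul hi] at h8
    have hunit : IsUnit (frobComponent i w) := by
      rw [isUnit_iff_red]
      intro h0
      apply hne
      have := coeff_red_frobComponent i 0 w
      rw [h0, zero_pow hp.ne_zero, mul_zero, zero_add] at this
      exact this.symm
    exact (Ideal.mul_unit_mem_iff_mem _ hunit).1 h8
  by_contra hcon
  have hzero : ∀ i < p, PowerSeries.coeff i (red p k w) = 0 := fun i hi => by
    by_contra h; exact hcon (key i hi h)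
  have hredw : red p k w = PowerSeries.X ^ α * red p k v - PowerSeries.X ^ e * red p k c +
      PowerSeries.X ^ d * red p k (frob p k c) := by
    simp only [hw, map_add, map_sub, map_mul, red_p, zero_mul, sub_zero, map_pow, red_X]
  have hvne := isUnit_iff_red.1 hv
  have hA := hzero α hαp
  rw [hredw, map_add, map_sub, PowerSeries.coeff_X_pow_mul', if_pos le_rfl, Nat.sub_self,
    PowerSeries.coeff_X_pow_mul', PowerSeries.coeff_X_pow_mul'] at hA
  rcases lt_or_gt_of_ne hα with hlt | hgt
  -- Here `α < d` and `α < e`, so only `u^α v` contributes at `α`, contradicting that `v` is a unit.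
  · have h9 : α ≤ p * α := Nat.le_mul_of_pos_left _ hp.pos
    rw [if_neg (by omega), if_neg (by omega), sub_zero, add_zero] at hA
    exact hvne hA
  · have hα0 : 0 < α := Nat.pos_of_ne_zero (by rintro h; rw [h] at hgt; omega)
    have h10 : 2 * α ≤ p * α := Nat.mul_le_mul_right _ hp.two_le
    -- Here `d < α` and `d < e`, so only `u^d φ(c)` contributes at `d`. Hence `c` has zero constant
    -- term modulo `p`.
    have hB := hzero d (by omega)
    rw [hredw, map_add, map_sub, PowerSeries.coeff_X_pow_mul', if_neg (by omega),
      PowerSeries.coeff_X_pow_mul', if_neg (by omega), PowerSeries.coeff_X_pow_mul',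
      if_pos le_rfl, Nat.sub_self, sub_zero, zero_add] at hB
    have hc0 : PowerSeries.coeff 0 (red p k c) = 0 := by
      have := red_frob_coeff_mul c 0
      rw [mul_zero, hB] at this
      exact pow_eq_zero_iff hp.ne_zero |>.1 this.symm
    -- Since `0 < α - d < p`, the term `u^d φ(c)` contributes nothing at `α`.
    have hnd : ¬ p ∣ α - d := fun h => by
      have := Nat.le_of_dvd (by omega) h
      omega
    rw [red_frob_coeff_of_not_dvd _ hnd, ite_self, add_zero] at hA
    -- The inequalities `2 α ≤ p α ≤ e + α` give `α ≤ e`, so `e ≤ α` forces equality and `u^e c`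
    -- contributes only the constant term of `c`, already zero.
    split_ifs at hA with heα
    · rw [show α - e = 0 by omega, hc0, sub_zero] at hA
      exact hvne hA
    · rw [sub_zero] at hA
      exact hvne hA

end KilledByP

/-! ### Torsion modules over a quotient that is a discrete valuation ring -/

section QuotientDVR

universe v

variable {R : Type v} [CommRing R] (I : Ideal R) [IsDomain (R ⧸ I)]
  [IsDiscreteValuationRing (R ⧸ I)] {x : R}

/-- `R / (I + x ^ a)` as a quotient of `R / I`. -/
noncomputable def quotQuotPowEquiv (x : R) (a : ℕ) :
    ((R ⧸ I) ⧸ Ideal.span {(Ideal.Quotient.mk I x) ^ a}) ≃ₗ[R] R ⧸ I ⊔ Ideal.span {x ^ a} :=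
  ((Ideal.quotientEquivAlgOfEq R (by
    rw [Ideal.map_span, Set.image_singleton, map_pow]; rfl)).trans
    (DoubleQuot.quotQuotEquivQuotSupₐ R I (Ideal.span {x ^ a}))).toLinearEquiv

theorem length_quotient_sup_span_pow (hx : Irreducible (Ideal.Quotient.mk I x)) (a : ℕ) :
    Module.length R (R ⧸ I ⊔ Ideal.span {x ^ a}) = a := by
  rw [← (quotQuotPowEquiv I x a).length_eq,
    Module.length_eq_of_surjective (R := R ⧸ I) Ideal.Quotient.mk_surjective]
  have := Ring.ord_pow (mem_nonZeroDivisors_of_ne_zero hx.ne_zero) a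
  rw [Ring.ord_of_irreducible hx, nsmul_one] at this
  exact this

/-- The structure theorem over the principal ideal domain `R ⧸ I`; all its irreducibles are
associated to the class of `x`. -/
theorem exists_equiv_pi_quotient_pow {M : Type*} [AddCommGroup M] [Module R M] [Module.Finite R M]
    (hx : Irreducible (Ideal.Quotient.mk I x)) (hI : I ≤ Module.annihilator R M) {r : ℕ}
    (hr : x ^ r ∈ Module.annihilator R M) :
    ∃ (ι : Type v) (_ : Fintype ι) (a : ι → ℕ),
      Nonempty (M ≃ₗ[R] Π i, R ⧸ I ⊔ Ideal.span {x ^ a i}) := by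
  have htors : Module.IsTorsionBySet R M I := fun m s =>
    Module.mem_annihilator.1 (hI s.2) m
  let _ : Module (R ⧸ I) M := htors.module
  have : IsScalarTower R (R ⧸ I) M := htors.isScalarTower
  have : Module.Finite (R ⧸ I) M := Module.Finite.of_restrictScalars_finite R _ _
  have hT : Module.IsTorsion (R ⧸ I) M := by
    intro m
    refine ⟨⟨Ideal.Quotient.mk I x ^ r,
      mem_nonZeroDivisors_of_ne_zero (pow_ne_zero _ hx.ne_zero)⟩, ?_⟩
    change Ideal.Quotient.mk I x ^ r • m = 0
    rw [← map_pow]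
    exact Module.mem_annihilator.1 hr m
  obtain ⟨ι, hι, q, hq, a, ⟨f⟩⟩ := Module.equiv_directSum_of_isTorsion hT
  classical
  have hspan : ∀ i, Submodule.span (R ⧸ I) {q i ^ a i} =
      Ideal.span {Ideal.Quotient.mk I x ^ a i} := fun i =>
    Ideal.span_singleton_eq_span_singleton.2
      ((IsDiscreteValuationRing.associated_of_irreducible _ (hq i) hx).pow_pow)
  let g : M ≃ₗ[R ⧸ I] Π i, (R ⧸ I) ⧸ Submodule.span (R ⧸ I) {q i ^ a i} :=
    f.trans (DirectSum.linearEquivFunOnFintype (R ⧸ I) ι _)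
  exact ⟨ι, hι, a, ⟨(g.restrictScalars R).trans (LinearEquiv.piCongrRight fun i =>
    ((Submodule.quotEquivOfEq _ _ (hspan i)).restrictScalars R).trans
      (quotQuotPowEquiv I x (a i)))⟩⟩

end QuotientDVR

/-! ### Frobenius twists of cyclic modules -/

section Twist

open scoped TensorProduct

variable {p : ℕ} [Fact p.Prime] {k : Type*} [Field k] [CharP k p] [PerfectRing k p]

/-- The isomorphism `𝔖 / p ≃ k⟦u⟧`. -/
noncomputable def redEquiv : (S p k ⧸ Ideal.span {(p : S p k)}) ≃+* PowerSeries k :=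
  (Ideal.quotEquivOfEq ker_red.symm).trans
    (RingHom.quotientKerEquivOfSurjective (red_surjective (p := p) (k := k)))

instance : IsDomain (S p k ⧸ Ideal.span {(p : S p k)}) :=
  Function.Injective.isDomain (redEquiv (p := p) (k := k)) redEquiv.injective

instance : IsDiscreteValuationRing (S p k ⧸ Ideal.span {(p : S p k)}) :=
  IsDiscreteValuationRing.RingEquivClass.isDiscreteValuationRing
    (redEquiv (p := p) (k := k)).symm

theorem irreducible_mk_X :
    Irreducible (Ideal.Quotient.mk (Ideal.span {(p : S p k)}) PowerSeries.X) := by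
  rw [← MulEquiv.irreducible_iff (redEquiv (p := p) (k := k))]
  have : redEquiv (p := p) (k := k) (Ideal.Quotient.mk (Ideal.span {(p : S p k)}) PowerSeries.X) =
    red p k PowerSeries.X := rfl
  rw [this, red_X]
  exact PowerSeries.X_irreducible

theorem frob_pow_X (n : ℕ) :
    (frob p k ^ n) PowerSeries.X = (PowerSeries.X : S p k) ^ p ^ n := by
  induction n with
  | zero => simp
  | succ n ih => rw [pow_succ, RingHom.mul_def, RingHom.comp_apply, frob_X, map_pow, ih, ← pow_mul,
      pow_succ]

/-- The cyclic module `𝔖 / (p, u ^ m)`. -/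
abbrev Cyclic (p : ℕ) [Fact p.Prime] (k : Type*) [Field k] (m : ℕ) : Type _ :=
  S p k ⧸ Ideal.span {(p : S p k)} ⊔ Ideal.span {(PowerSeries.X : S p k) ^ m}

/-- An isomorphism of modules over the copy `TwistRing p k n` of `𝔖` is one over `𝔖`. -/
def twistRingEquiv (n : ℕ) {A B : Type*} [AddCommGroup A] [i₁ : Module (TwistRing p k n) A]
    [AddCommGroup B] [i₂ : Module (TwistRing p k n) B] (f : A ≃ₗ[TwistRing p k n] B) :
    letI : Module (S p k) A := i₁
    letI : Module (S p k) B := i₂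
    A ≃ₗ[S p k] B := f

/-- Twisting preserves isomorphisms. -/
noncomputable def twistCongr (n : ℕ) {M M' : Type*} [AddCommGroup M] [Module (S p k) M]
    [AddCommGroup M'] [Module (S p k) M'] (f : M ≃ₗ[S p k] M') :
    Twist p k n M ≃ₗ[S p k] Twist p k n M' :=
  let g := twistRingEquiv n (f.baseChange (S p k) (TwistRing p k n) M M')
  g

/-- Twisting commutes with finite products. -/
noncomputable def twistPi (n : ℕ) {ι : Type*} [Fintype ι] [DecidableEq ι] (M : ι → Type*)
    [∀ i, AddCommGroup (M i)] [∀ i, Module (S p k) (M i)] :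
    Twist p k n (Π i, M i) ≃ₗ[S p k] Π i, Twist p k n (M i) :=
  let g := twistRingEquiv n
    (TensorProduct.piRight (S p k) (TwistRing p k n) (TwistRing p k n) M)
  g

/-- The twist of `𝔖 / (p, u ^ m)`. -/
noncomputable def twistCyclic (n m : ℕ) :
    Twist p k n (Cyclic p k m) ≃ₗ[S p k] Cyclic p k (p ^ n * m) :=
  let I : Ideal (S p k) := Ideal.span {(p : S p k)} ⊔ Ideal.span {PowerSeries.X ^ m}
  let g := twistRingEquiv n (Algebra.TensorProduct.quotIdealMapEquivTensorQuot
    (TwistRing p k n) I).symm.toLinearEquiv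
  let e₁ : Twist p k n (Cyclic p k m) ≃ₗ[S p k] S p k ⧸ I.map (frob p k ^ n) := g
  e₁.trans (Submodule.quotEquivOfEq _ _ (by
    rw [Ideal.map_sup, Ideal.map_span, Ideal.map_span, Set.image_singleton, Set.image_singleton,
      map_natCast, map_pow, frob_pow_X, ← pow_mul]))

end Twist

/-! ### Length of the torsion submodule -/

section TorsionLength

variable {R : Type*} [CommRing R] (E : R)

theorem length_torsionBy_le_of_injective {T T' : Type*} [AddCommGroup T] [Module R T]
    [AddCommGroup T'] [Module R T'] (f : T →ₗ[R] T') (hf : Function.Injective f) :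
    Module.length R (Submodule.torsionBy R T E) ≤ Module.length R (Submodule.torsionBy R T' E) := by
  refine Module.length_le_of_injective (f.restrict (p := Submodule.torsionBy R T E)
    (q := Submodule.torsionBy R T' E) fun x hx => ?_) fun x y h => ?_
  · rw [Submodule.mem_torsionBy_iff] at hx ⊢
    rw [← map_smul, hx, map_zero]
  · exact Subtype.ext (hf (congrArg Subtype.val h))

theorem length_torsionBy_eq {T T' : Type*} [AddCommGroup T] [Module R T]
    [AddCommGroup T'] [Module R T'] (f : T ≃ₗ[R] T') :
    Module.length R (Submodule.torsionBy R T E) = Module.length R (Submodule.torsionBy R T' E) :=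
  le_antisymm (length_torsionBy_le_of_injective E f.toLinearMap f.injective)
    (length_torsionBy_le_of_injective E f.symm.toLinearMap f.symm.injective)

theorem length_torsionBy_pi {ι : Type*} [Fintype ι] (T : ι → Type*) [∀ i, AddCommGroup (T i)]
    [∀ i, Module R (T i)] :
    Module.length R (Submodule.torsionBy R (Π i, T i) E) =
      ∑ i, Module.length R (Submodule.torsionBy R (T i) E) := by
  rw [← Module.length_pi_of_fintype]
  let f : Submodule.torsionBy R (Π i, T i) E ≃ₗ[R] Π i, Submodule.torsionBy R (T i) E :=
    { toFun := fun x i => ⟨x.1 i, congrFun x.2 i⟩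
      invFun := fun y => ⟨fun i => (y i).1, funext fun i => (y i).2⟩
      map_add' := fun _ _ => rfl
      map_smul' := fun _ _ => rfl
      left_inv := fun _ => rfl
      right_inv := fun _ => rfl }
  exact f.length_eq

end TorsionLength

/-! ### The `E`-torsion of a cyclic module -/

section Cyclic

variable {p : ℕ} [Fact p.Prime] {k : Type*} [Field k] [CharP k p] [PerfectRing k p]

theorem cyclic_mk_eq_zero_iff {m : ℕ} {s : S p k} :
    (Submodule.Quotient.mk s : Cyclic p k m) = 0 ↔
      (PowerSeries.X : PowerSeries k) ^ m ∣ red p k s := by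
  rw [Submodule.Quotient.mk_eq_zero, mem_span_p_sup_iff]

/-- Multiplication by `u^d` embeds `𝔖/(p, u^m)` into `𝔖/(p, u^(m+d))`. -/
theorem length_torsionBy_cyclic_mono (E : S p k) {m m' : ℕ} (h : m ≤ m') :
    Module.length (S p k) (Submodule.torsionBy (S p k) (Cyclic p k m) E) ≤
      Module.length (S p k) (Submodule.torsionBy (S p k) (Cyclic p k m') E) := by
  obtain ⟨d, rfl⟩ := Nat.exists_eq_add_of_le h
  have hX : (PowerSeries.X : PowerSeries k) ^ d ≠ 0 := pow_ne_zero _ PowerSeries.X_ne_zero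
  have key : ∀ s : S p k, (PowerSeries.X : PowerSeries k) ^ (m + d) ∣
      red p k (PowerSeries.X ^ d * s) ↔ (PowerSeries.X : PowerSeries k) ^ m ∣ red p k s := by
    intro s
    rw [map_mul, map_pow, red_X, add_comm m d, pow_add, mul_dvd_mul_iff_left hX]
  let f : Cyclic p k m →ₗ[S p k] Cyclic p k (m + d) :=
    Submodule.mapQ _ _ (LinearMap.mulLeft (S p k) (PowerSeries.X ^ d)) fun s hs => by
      rw [Submodule.mem_comap, mem_span_p_sup_iff, LinearMap.mulLeft_apply, key]
      exact mem_span_p_sup_iff.1 hs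
  refine length_torsionBy_le_of_injective E f ?_
  rw [injective_iff_map_eq_zero]
  intro x hx
  obtain ⟨s, rfl⟩ := Submodule.Quotient.mk_surjective _ x
  rw [Submodule.mapQ_apply, cyclic_mk_eq_zero_iff, LinearMap.mulLeft_apply, key] at hx
  exact cyclic_mk_eq_zero_iff.2 hx

theorem length_torsionBy_cyclic_zero (E : S p k) :
    Module.length (S p k) (Submodule.torsionBy (S p k) (Cyclic p k 0) E) = 0 := by
  have : Subsingleton (Cyclic p k 0) := by
    refine ⟨fun x y => ?_⟩
    obtain ⟨s, rfl⟩ := Submodule.Quotient.mk_surjective _ x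
    obtain ⟨t, rfl⟩ := Submodule.Quotient.mk_surjective _ y
    rw [← sub_eq_zero, ← Submodule.Quotient.mk_sub, cyclic_mk_eq_zero_iff]
    simp
  exact Module.length_eq_zero

theorem one_le_length_torsionBy_cyclic {E : S p k} {e : ℕ} (hE : red p k E = PowerSeries.X ^ e)
    (he : 0 < e) {m : ℕ} (hm : 0 < m) :
    1 ≤ Module.length (S p k) (Submodule.torsionBy (S p k) (Cyclic p k m) E) := by
  rw [Order.one_le_iff_pos, Module.length_pos_iff]
  -- The socle generator `u^(m-1)` is killed by `u`, hence by `E` because `e > 0`.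
  refine ⟨⟨⟨Submodule.Quotient.mk (PowerSeries.X ^ (m - 1)), ?_⟩, 0, fun h => ?_⟩⟩
  · rw [Submodule.mem_torsionBy_iff, ← Submodule.Quotient.mk_smul, cyclic_mk_eq_zero_iff,
      smul_eq_mul, map_mul, hE, map_pow, red_X, ← pow_add]
    exact pow_dvd_pow _ (by omega)
  · have h' := cyclic_mk_eq_zero_iff.1 (congrArg Subtype.val h)
    rw [map_pow, red_X, pow_dvd_pow_iff PowerSeries.X_ne_zero PowerSeries.X_irreducible.not_isUnit]
      at h'
    omega

/-- By monotonicity `m` may be replaced by `m + e`. There the torsion is the image of multiplication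
by `u^m` from `𝔖/(p, u^e)`, which has length `e`. -/
theorem length_torsionBy_cyclic_le {E : S p k} {e : ℕ} (hE : red p k E = PowerSeries.X ^ e)
    (m : ℕ) :
    Module.length (S p k) (Submodule.torsionBy (S p k) (Cyclic p k m) E) ≤ e := by
  refine (length_torsionBy_cyclic_mono E (Nat.le_add_right m e)).trans ?_
  rw [← length_quotient_sup_span_pow _ (irreducible_mk_X (p := p) (k := k)) e]
  have hXe : (PowerSeries.X : PowerSeries k) ^ e ≠ 0 := pow_ne_zero _ PowerSeries.X_ne_zero
  have hXm : (PowerSeries.X : PowerSeries k) ^ m ≠ 0 := pow_ne_zero _ PowerSeries.X_ne_zero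
  let f : Cyclic p k e →ₗ[S p k] Cyclic p k (m + e) :=
    Submodule.mapQ _ _ (LinearMap.mulLeft (S p k) (PowerSeries.X ^ m)) fun s hs => by
      rw [Submodule.mem_comap, mem_span_p_sup_iff, LinearMap.mulLeft_apply, map_mul, map_pow, red_X,
        pow_add, mul_dvd_mul_iff_left hXm]
      exact mem_span_p_sup_iff.1 hs
  have hf : ∀ x, f x ∈ Submodule.torsionBy (S p k) (Cyclic p k (m + e)) E := by
    intro x
    obtain ⟨s, rfl⟩ := Submodule.Quotient.mk_surjective _ x
    rw [Submodule.mem_torsionBy_iff, Submodule.mapQ_apply, ← Submodule.Quotient.mk_smul,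
      cyclic_mk_eq_zero_iff, smul_eq_mul, map_mul, hE, LinearMap.mulLeft_apply, map_mul, map_pow,
      red_X, ← mul_assoc, ← pow_add, add_comm]
    exact dvd_mul_right _ _
  refine Module.length_le_of_surjective (f.codRestrict _ hf) ?_
  rintro ⟨x, hx⟩
  obtain ⟨s, rfl⟩ := Submodule.Quotient.mk_surjective _ x
  rw [Submodule.mem_torsionBy_iff, ← Submodule.Quotient.mk_smul, cyclic_mk_eq_zero_iff,
    smul_eq_mul, map_mul, hE, add_comm, pow_add, mul_dvd_mul_iff_left hXe] at hx
  obtain ⟨g, hg⟩ := hx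
  obtain ⟨t, rfl⟩ := red_surjective (p := p) g
  refine ⟨Submodule.Quotient.mk t, Subtype.ext ?_⟩
  change (Submodule.Quotient.mk (PowerSeries.X ^ m * t) : Cyclic p k (m + e)) = _
  rw [← sub_eq_zero, ← Submodule.Quotient.mk_sub, cyclic_mk_eq_zero_iff, map_sub, map_mul, map_pow,
    red_X, hg, sub_self]
  exact dvd_zero _

end Cyclic

/-! ### Lengths of the twists -/

section Length

variable {p : ℕ} [Fact p.Prime] {k : Type*} [Field k] [CharP k p] [PerfectRing k p]

theorem length_torsionBy_twist {ι : Type*} [Fintype ι] {a : ι → ℕ} {M : Type*} [AddCommGroup M]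
    [Module (S p k) M] (f : M ≃ₗ[S p k] Π i, Cyclic p k (a i)) (E : S p k) (n : ℕ) :
    Module.length (S p k) (Submodule.torsionBy (S p k) (Twist p k n M) E) =
      ∑ i, Module.length (S p k) (Submodule.torsionBy (S p k) (Cyclic p k (p ^ n * a i)) E) := by
  classical
  rw [← length_torsionBy_pi]
  exact length_torsionBy_eq E ((twistCongr n f).trans
    ((twistPi n _).trans (LinearEquiv.piCongrRight fun i => twistCyclic n (a i))))

variable {K : Type*} [Field K] [Algebra (W p k) K] [Algebra (K₀ p k) K]
  [IsScalarTower (W p k) (K₀ p k) K] [FiniteDimensional (K₀ p k) K]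

/-- Length does not change along surjective ring maps, and `𝔖` and `𝒪_K` both surject onto `𝔖/E`. -/
theorem lengthETorsion_eq (hK : IsTotallyRamified p k K) {π : OK p k K} (hπ : Irreducible π)
    (T : Type*) [AddCommGroup T] [Module (S p k) T] :
    lengthETorsion hK hπ T =
      Module.length (S p k) (Submodule.torsionBy (S p k) T (eisenstein π)) := by
  have h₁ : Module.length (S p k) (Submodule.torsionBy (S p k) T (eisenstein π)) =
      Module.length (S p k ⧸ Ideal.span {eisenstein π})
        (Submodule.torsionBy (S p k) T (eisenstein π)) :=
    Module.length_eq_of_surjective Ideal.Quotient.mk_surjective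
  rw [h₁]
  let _ : Algebra (OK p k K) (S p k ⧸ Ideal.span {eisenstein π}) :=
    (nat hK hπ : OK p k K →+* S p k ⧸ Ideal.span {eisenstein π}).toAlgebra
  let _ : Module (OK p k K) (Submodule.torsionBy (S p k) T (eisenstein π)) :=
    Module.compHom _ (nat hK hπ : OK p k K →+* S p k ⧸ Ideal.span {eisenstein π})
  have : IsScalarTower (OK p k K) (S p k ⧸ Ideal.span {eisenstein π})
      (Submodule.torsionBy (S p k) T (eisenstein π)) :=
    ⟨fun a b x => mul_smul (nat hK hπ a) b x⟩
  exact Module.length_eq_of_surjective (S := OK p k K) (nat hK hπ).surjective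

end Length

end BreuilKisin

/-! ### The main theorem -/

theorem mainTheorem11
    {p : ℕ} [Fact p.Prime] {k : Type*} [Field k] [CharP k p] [PerfectRing k p]
    {K : Type*} [Field K] [Algebra (BreuilKisin.W p k) K] [Algebra (BreuilKisin.K₀ p k) K]
    [IsScalarTower (BreuilKisin.W p k) (BreuilKisin.K₀ p k) K]
    [FiniteDimensional (BreuilKisin.K₀ p k) K]
    (hK : BreuilKisin.IsTotallyRamified p k K)
    {π : BreuilKisin.OK p k K} (hπ : Irreducible π)
    {e : ℕ} (he : e = Module.finrank (BreuilKisin.K₀ p k) K)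
    {M N : Type*} [AddCommGroup M] [Module (BreuilKisin.S p k) M]
    [AddCommGroup N] [Module (BreuilKisin.S p k) N]
    {i : ℕ} (hi : i ≤ 2)
    (_𝔐 : BreuilKisin.QuasiFilteredBKModule (BreuilKisin.eisenstein π) i M N)
    (hu : BreuilKisin.IsUPowTorsion p k M)
    (hα : p * BreuilKisin.alpha p k M ≠ e)
    (hep : e < p * (p - 1)) :
    (∀ n : ℕ,
      BreuilKisin.lengthETorsion hK hπ (BreuilKisin.Twist p k (n + 1) M) ≥
        BreuilKisin.lengthETorsion hK hπ (BreuilKisin.Twist p k n M)) ∧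
    (e : ℕ∞) * BreuilKisin.lengthETorsion hK hπ (BreuilKisin.Twist p k 1 M) ≥
      BreuilKisin.lengthETorsion hK hπ
        (BreuilKisin.Twist p k (BreuilKisin.twistBound p e + 1) M) := by
  open BreuilKisin in
  have hp : 0 < p := (Fact.out : p.Prime).pos
  have hepos : 0 < e := he ▸ Module.finrank_pos
  have := _𝔐.finite
  obtain ⟨v, hv, hE⟩ := exists_eisenstein_eq hK hπ
  rw [← he] at hE
  have hred : red p k (eisenstein π) = PowerSeries.X ^ e := by
    rw [hE, map_add, map_mul, red_p, zero_mul, add_zero, map_pow, red_X]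
  have hpM := p_mem_annihilator hu hepos hv hE
    (fun s hs => _𝔐.mul_mem_annihilator_twist hi hs) hα hep
  obtain ⟨r, hr⟩ := hu.exists_pow_mem_annihilator
  obtain ⟨ι, _, a, ⟨f⟩⟩ := exists_equiv_pi_quotient_pow (Ideal.span {(p : S p k)})
    irreducible_mk_X ((Ideal.span_singleton_le_iff_mem _).2 hpM) hr
  simp only [lengthETorsion_eq, length_torsionBy_twist f, ge_iff_le]
  refine ⟨fun n => Finset.sum_le_sum fun j _ => length_torsionBy_cyclic_mono _
    (Nat.mul_le_mul_right _ (Nat.pow_le_pow_right hp n.le_succ)), ?_⟩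
  rw [Finset.mul_sum]
  refine Finset.sum_le_sum fun j _ => ?_
  -- The decomposition may contain zero summands, for which the lower bound `1` fails but both
  -- lengths vanish. For the others the upper bound `e` holds at every twist.
  rcases Nat.eq_zero_or_pos (a j) with h | h
  · rw [h, mul_zero, length_torsionBy_cyclic_zero]
    exact zero_le
  · calc _ ≤ (e : ℕ∞) := length_torsionBy_cyclic_le hred _
      _ = e * 1 := (mul_one _).symm
      _ ≤ _ := mul_le_mul_right (one_le_length_torsionBy_cyclic hred hepos
        (Nat.mul_pos (pow_pos hp 1) h)) _
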